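/- **Problem.** In \textsc{$H$-free Deletion [VC]} the input consists of a finite simple graph $G$ on the vertex set $\{0,\dots,n-1\}$, a vertex cover $X$ of $G$ with $|X| = K$, a finite simple graph $H$ on $h$ vertices, and an integer $\ell \ge 0$. The question is whether there is a set $S \subseteq V(G)$ with $|S| \le \ell$ such that $G[V(G)\setminus S]$ has no induced subgraph isomorphic to $H$. **Model.** In the adjacency-list (AL) streaming model the graph $G$ is given as a stream in which every vertex (isolated ones included) arrives exactly once, in arbitrary order, and the arrival of a vertex $v$ is followed by the list of all neighbours of $v$, one after the other and each exactly once, in arbitrary order (so each edge of $G$ appears twice). A deterministic multi-pass streaming algorithm has a memory consisting of bits. The memory is initialised from $n$, $X$, $H$ and $\ell$; whatever the algorithm needs to remember of these counts as memory. The algorithm then reads the same stream from beginning to end in several passes, updating its memory after each item and at the end of each pass; before the first pass and after each pass it may stop and answer YES or NO. The computation between two reads is unrestricted; the cost is the number of passes and the maximum number of bits held in memory at any time (at the start, between two items, after each pass). **Theorem.** There are a single deterministic streaming algorithm in the AL model and an absolute constant $C$ such that, for all $n, h, \ell \ge 0$, every graph $G$ on $n$ vertices with a given vertex cover $X$ of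 size $K$, every graph $H$ on $h$ vertices with at least one edge, and every AL stream of $G$, the algorithm halts with the correct answer to \textsc{$H$-free Deletion [VC]} after at most $$C\cdot 2^K h^{K+2} K^h\, h! \qquad\text{and also at most}\qquad C\cdot 2^K h^{K+2} K!\, h!$$ passes, and uses at most $C\,(K+h^2)\log_2 n$ bits of memory (where $\log_2 0$ is read as $0$). -/

import Mathlib

/-- The items of an adjacency-list stream, with vertices named by natural numbers:
`vertex v` announces the arrival of the vertex `v`, and each following `neighbor u` is one
entry of the adjacency list of that vertex. -/
inductive ALToken : Type
  | vertex (v : ℕ) : ALToken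
  | neighbor (u : ℕ) : ALToken

/-- `blocks` presents the graph `G` on the vertex set `{0, …, n - 1}` in the adjacency-list (AL)
model: every vertex arrives exactly once, in an arbitrary order, together with all its incident
edges, listed once each in an arbitrary order. Thus every edge of `G` occurs twice. -/
structure IsALPresentation {n : ℕ} (G : SimpleGraph (Fin n))
    (blocks : List (Fin n × List (Fin n))) : Prop where
  vertices_nodup : (blocks.map Prod.fst).Nodup
  vertices_complete : ∀ v : Fin n, v ∈ blocks.map Prod.fst
  neighbors_nodup : ∀ b ∈ blocks, b.2.Nodup
  mem_neighbors_iff : ∀ b ∈ blocks, ∀ u : Fin n, u ∈ b.2 ↔ G.Adj b.1 u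

/-- The stream of single items that is read in one pass. -/
def alStream {n : ℕ} (blocks : List (Fin n × List (Fin n))) : List ALToken :=
  blocks.flatMap fun b =>
    ALToken.vertex b.1 :: b.2.map fun u => ALToken.neighbor u

/-- A deterministic multi-pass streaming algorithm for `H`-free Deletion with a given vertex
cover. Its whole memory is a string of bits. Before the first pass the memory is initialised from
the number `n` of vertices of the streamed graph, the given vertex cover `X`, the forbidden graph
`H` and the budget `ℓ`; the streamed graph itself is accessible only through the stream, and
afterwards `n`, `X`, `H`, `ℓ` are accessible only as far as they are kept in memory.
`step` processes one item of the stream, `endPass` is applied at the end of each pass, and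
`output`, consulted before the first pass and after each pass, either halts with an answer or
(value `none`) asks for another pass. All maps are fixed once and for all, independently of the
instance. Computation between two reads is not restricted: only passes and memory are charged. -/
structure StreamingAlgorithm where
  init : (n : ℕ) → (X : Finset (Fin n)) → (h : ℕ) → (H : SimpleGraph (Fin h)) → (ℓ : ℕ) →
    List Bool
  step : List Bool → ALToken → List Bool
  endPass : List Bool → List Bool
  output : List Bool → Option Bool

namespace StreamingAlgorithm

/-- The memory after reading the items `τ`, starting from the memory `m`. -/
def read (A : StreamingAlgorithm) (m : List Bool) (τ : List ALToken) : List Bool :=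
  τ.foldl A.step m

/-- The memory after `q` full passes over the stream `σ`, starting from the memory `m`. -/
def afterPasses (A : StreamingAlgorithm) (σ : List ALToken) (m : List Bool) : ℕ → List Bool
  | 0 => m
  | q + 1 => A.endPass (A.read (A.afterPasses σ m q) σ)

/-- Started with memory `m` on the stream `σ`, the algorithm makes exactly `p` passes and then
halts with the answer `ans`. -/
def HaltsAfter (A : StreamingAlgorithm) (σ : List ALToken) (m : List Bool) (p : ℕ)
    (ans : Bool) : Prop :=
  (∀ q < p, A.output (A.afterPasses σ m q) = none) ∧
    A.output (A.afterPasses σ m p) = some ans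

/-- During its first `p` passes over `σ` (including the start, the end, and every moment between
two items of the stream) the memory never holds more than `s` bits. -/
def UsesSpaceAtMost (A : StreamingAlgorithm) (σ : List ALToken) (m : List Bool) (p : ℕ)
    (s : ℝ) : Prop :=
  (∀ q ≤ p, ((A.afterPasses σ m q).length : ℝ) ≤ s) ∧
    ∀ q < p, ∀ τ : List ALToken, τ <+: σ →
      ((A.read (A.afterPasses σ m q) τ).length : ℝ) ≤ s

end StreamingAlgorithm

/-- The question of `H`-free Deletion: can one delete at most `ℓ` vertices from `G` such that the
remaining graph has no induced subgraph isomorphic to `H`? -/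
def HFreeDeletion {n h : ℕ} (G : SimpleGraph (Fin n)) (H : SimpleGraph (Fin h)) (ℓ : ℕ) : Prop :=
  ∃ S : Finset (Fin n), S.card ≤ ℓ ∧
    ¬ H.IsIndContained (G.induce {v : Fin n | v ∉ S})

/-! Finding a copy. Fix a set S of deleted vertices. A copy of H avoiding S induces a partial map φ
from H to the cover X, with value `none` where the copy leaves X. There are (K+1)^h such maps, and
one pass tests one of them. Vertices outside X are pairwise non-adjacent, so whether such a vertex
may play a given role depends only on its neighbours in X. Two roles that some vertex fits both
accept the same vertices, so a greedy assignment never blocks itself: it fills every role whenever φ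
comes from a copy (`exists_passResult_ne_none`), and what it returns is a copy
(`isCopy_of_passResult_eq_some`).

Branching. A solution meets every copy, so some word over the vertices of H says which vertex to
delete from each copy found (`exists_trace_eq_none`). If ℓ ≥ K, deleting X destroys every edge and
the answer is YES. Otherwise ℓ < K, and words of length K suffice. They are tried one by one, each
from the empty set. All passes read the same stream, so a pass result depends only on S and the
guess, and no stack of copies is needed. There are at most h^K words, K deletion levels and (K+1)^h
guesses; their product bounds the passes, and elementary inequalities turn it into the two stated
bounds.

Memory. For fixed n, h, K there are at most n^(10(K+h^2)) search states. Numbering them and writing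
the number in binary, together with n, h and K, takes O((K+h^2) log n) bits. -/

namespace HFreeStreaming

open Function Classical

noncomputable section

/-- `g` is an induced copy of `H` in `G` that avoids the vertices in `S`. -/
def IsCopy {n h : ℕ} (G : SimpleGraph (Fin n)) (H : SimpleGraph (Fin h)) (S : Finset (Fin n))
    (g : Fin h → Fin n) : Prop :=
  Injective g ∧ (∀ a, g a ∉ S) ∧ ∀ a b, H.Adj a b ↔ G.Adj (g a) (g b)

theorem isIndContained_induce_iff {n h : ℕ} (G : SimpleGraph (Fin n)) (H : SimpleGraph (Fin h))
    (S : Finset (Fin n)) :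
    H.IsIndContained (G.induce {v : Fin n | v ∉ S}) ↔ ∃ g, IsCopy G H S g := by
  constructor
  · rintro ⟨e⟩
    refine ⟨fun a => (e a : Fin n), fun a b hab => e.injective (Subtype.ext hab),
      fun a => (e a).2, fun a b => ?_⟩
    rw [← e.map_adj_iff]
    rfl
  · rintro ⟨g, hg, hS, hadj⟩
    exact ⟨⟨⟨fun a => ⟨g a, hS a⟩, fun a b hab => hg (congrArg Subtype.val hab)⟩,
      fun {a b} => (hadj a b).symm⟩⟩

theorem hFreeDeletion_iff {n h : ℕ} (G : SimpleGraph (Fin n)) (H : SimpleGraph (Fin h)) (ℓ : ℕ) :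
    HFreeDeletion G H ℓ ↔ ∃ S : Finset (Fin n), S.card ≤ ℓ ∧ ∀ g, ¬ IsCopy G H S g := by
  simp only [HFreeDeletion, isIndContained_induce_iff, not_exists]

/-! ### One pass: extending a guessed partial embedding into the vertex cover -/

/-- The value `none` stands for a vertex of H placed outside X, which leaves K+1 choices per vertex.
-/
theorem exists_guess_enumeration {n : ℕ} (X : Finset (Fin n)) (h : ℕ) :
    ∃ e : ℕ → Fin h → Option (Fin n), ∀ φ : Fin h → Option (Fin n),
      (∀ a v, φ a = some v → v ∈ X) → ∃ c < (X.card + 1) ^ h, e c = φ := by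
  have hcard : Fintype.card (Fin h → Option X) = (X.card + 1) ^ h := by simp
  let E := Fintype.equivFinOfCardEq hcard
  refine ⟨fun c => if hc : c < (X.card + 1) ^ h then
    fun a => (E.symm ⟨c, hc⟩ a).map Subtype.val else fun _ => none, fun φ hφ => ?_⟩
  refine ⟨E fun a => (φ a).pmap (fun v hv => ⟨v, hv⟩) (hφ a), (E _).2, ?_⟩
  funext a
  simp only [Fin.is_lt, dite_true, Fin.eta, Equiv.symm_apply_apply]
  simp [Option.map_pmap, Option.pmap_eq_map]

/-- The `c`-th partial map from the vertices of `H` to the vertex cover `X`. -/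
def guess {n : ℕ} (X : Finset (Fin n)) (h c : ℕ) : Fin h → Option (Fin n) :=
  (exists_guess_enumeration X h).choose c

theorem exists_guess_eq {n h : ℕ} {X : Finset (Fin n)} {φ : Fin h → Option (Fin n)}
    (hφ : ∀ a v, φ a = some v → v ∈ X) : ∃ c < (X.card + 1) ^ h, guess X h c = φ :=
  (exists_guess_enumeration X h).choose_spec φ hφ

/-- The vertex `v`, with set `N` of neighbours in `X`, may play the role of the vertex `a` of `H`
if the vertices of `H` are mapped into `X` according to `φ`. -/
def Fits {n h : ℕ} (X : Finset (Fin n)) (H : SimpleGraph (Fin h)) (φ : Fin h → Option (Fin n))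
    (v : Fin n) (N : Finset (Fin n)) (a : Fin h) : Prop :=
  φ a = (if v ∈ X then some v else none) ∧ ∀ b u, φ b = some u → (H.Adj a b ↔ u ∈ N)

/-- Greedy assignment of the vertex `v` to a free vertex of `H` that it fits. -/
def assign {n h : ℕ} (X : Finset (Fin n)) (H : SimpleGraph (Fin h)) (S : Finset (Fin n))
    (φ : Fin h → Option (Fin n)) (f : Fin h → Option (Fin n)) (v : Fin n) (N : Finset (Fin n)) :
    Fin h → Option (Fin n) :=
  if hv : v ∉ S ∧ ∃ a, f a = none ∧ Fits X H φ v N a then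
    update f hv.2.choose (some v) else f

/-- The copy of `H` found by a pass which ends with the assignment `f`, if any. -/
def outcome {n h : ℕ} (H : SimpleGraph (Fin h)) (φ f : Fin h → Option (Fin n)) :
    Option (Fin h → Fin n) :=
  if hf : (∀ a, (f a).isSome) ∧ ∀ a b, φ a = none → φ b = none → ¬ H.Adj a b then
    some fun a => (f a).get (hf.1 a) else none

/-- The neighbours of `v` in `X`. -/
def coverNeighbors {n : ℕ} (G : SimpleGraph (Fin n)) (X : Finset (Fin n)) (v : Fin n) :
    Finset (Fin n) :=
  X.filter fun u => G.Adj v u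

/-- The assignment after the blocks of the vertices in `L` have been processed. -/
def greedy {n h : ℕ} (G : SimpleGraph (Fin n)) (X : Finset (Fin n)) (H : SimpleGraph (Fin h))
    (S : Finset (Fin n)) (φ : Fin h → Option (Fin n)) (L : List (Fin n)) :
    Fin h → Option (Fin n) :=
  L.foldl (fun f v => assign X H S φ f v (coverNeighbors G X v)) fun _ => none

/-- The field `maximal` is the only trace of greediness: a role still free at the end was free all
along, so each vertex that fits it must have been used elsewhere. -/
structure GreedyInvariant {n h : ℕ} (G : SimpleGraph (Fin n)) (X : Finset (Fin n))
    (H : SimpleGraph (Fin h)) (S : Finset (Fin n)) (φ f : Fin h → Option (Fin n))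
    (L : List (Fin n)) : Prop where
  sound : ∀ a v, f a = some v → v ∈ L ∧ v ∉ S ∧ Fits X H φ v (coverNeighbors G X v) a
  inj : ∀ a b v, f a = some v → f b = some v → a = b
  maximal : ∀ v ∈ L, v ∉ S → ∀ a, Fits X H φ v (coverNeighbors G X v) a → f a = none →
    ∃ b, f b = some v

theorem greedyInvariant_greedy {n h : ℕ} (G : SimpleGraph (Fin n)) (X : Finset (Fin n))
    (H : SimpleGraph (Fin h)) (S : Finset (Fin n)) (φ : Fin h → Option (Fin n))
    (L : List (Fin n)) (hL : L.Nodup) :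
    GreedyInvariant G X H S φ (greedy G X H S φ L) L := by
  induction L using List.reverseRecOn with
  | nil => constructor <;> simp [greedy]
  | append_singleton L v ih =>
    rw [List.nodup_append] at hL
    have ih := ih hL.1
    have hvL : v ∉ L := fun hv => hL.2.2 v hv v (by simp) rfl
    have hstep : greedy G X H S φ (L ++ [v]) =
        assign X H S φ (greedy G X H S φ L) v (coverNeighbors G X v) := by
      simp [greedy]
    rw [hstep]
    generalize greedy G X H S φ L = f at ih
    unfold assign
    split_ifs with hv
    · obtain ⟨hfree, hfit⟩ := hv.2.choose_spec
      generalize hv.2.choose = a₀ at hfree hfit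
      refine ⟨fun a w hw => ?_, fun a b w ha hb => ?_, fun w hw hwS a hfa hnone => ?_⟩
      · by_cases haa : a = a₀
        · subst haa
          simp only [update_self, Option.some.injEq] at hw
          subst hw
          exact ⟨by simp, hv.1, hfit⟩
        · rw [update_of_ne haa] at hw
          have := ih.sound a w hw
          exact ⟨by simp [this.1], this.2⟩
      · by_cases haa : a = a₀ <;> by_cases hbb : b = a₀
        · rw [haa, hbb]
        · rw [haa, update_self, Option.some.injEq] at ha
          rw [update_of_ne hbb] at hb
          exact absurd (ih.sound b w hb).1 (ha ▸ hvL)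
        · rw [hbb, update_self, Option.some.injEq] at hb
          rw [update_of_ne haa] at ha
          exact absurd (ih.sound a w ha).1 (hb ▸ hvL)
        · rw [update_of_ne haa] at ha
          rw [update_of_ne hbb] at hb
          exact ih.inj a b w ha hb
      · have haa : a ≠ a₀ := by
          rintro rfl
          simp at hnone
        rw [update_of_ne haa] at hnone
        rcases List.mem_append.1 hw with hw | hw
        · obtain ⟨b, hb⟩ := ih.maximal w hw hwS a hfa hnone
          have hba : b ≠ a₀ := by
            rintro rfl
            simp [hfree] at hb
          exact ⟨b, by rw [update_of_ne hba, hb]⟩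
        · rw [List.mem_singleton] at hw
          exact ⟨a₀, by rw [update_self, hw]⟩
    · refine ⟨fun a w hw => ?_, ih.inj, fun w hw hwS a hfa hnone => ?_⟩
      · have := ih.sound a w hw
        exact ⟨by simp [this.1], this.2⟩
      · rcases List.mem_append.1 hw with hw | hw
        · exact ih.maximal w hw hwS a hfa hnone
        · rw [List.mem_singleton] at hw
          subst hw
          exact absurd ⟨hwS, a, hnone, hfa⟩ hv

/-- The copy of `H` avoiding `S` found with the `c`-th guess when the vertices arrive in the
order `L`, if any. -/
def passResult {n h : ℕ} (G : SimpleGraph (Fin n)) (X : Finset (Fin n)) (H : SimpleGraph (Fin h))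
    (L : List (Fin n)) (S : Finset (Fin n)) (c : ℕ) : Option (Fin h → Fin n) :=
  outcome H (guess X h c) (greedy G X H S (guess X h c) L)

/-- `Fits` checks each pair with an endpoint in X. For the other pairs, G has no edge because X is a
cover, and H has none by the test in `outcome`. -/
theorem isCopy_of_passResult_eq_some {n h : ℕ} {G : SimpleGraph (Fin n)} {X : Finset (Fin n)}
    {H : SimpleGraph (Fin h)} {L : List (Fin n)} {S : Finset (Fin n)} {c : ℕ}
    (hX : G.IsVertexCover (X : Set (Fin n))) (hL : L.Nodup) {g : Fin h → Fin n}
    (hg : passResult G X H L S c = some g) : IsCopy G H S g := by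
  have inv := greedyInvariant_greedy G X H S (guess X h c) L hL
  unfold passResult outcome at hg
  generalize guess X h c = φ at *
  generalize greedy G X H S φ L = f at *
  split_ifs at hg with hf
  obtain ⟨hsome, hindep⟩ := hf
  rw [Option.some.injEq] at hg
  have hfg : ∀ a, f a = some (g a) := fun a => by simp [← hg]
  have hfit := fun a => (inv.sound a (g a) (hfg a)).2.2
  have key : ∀ a b, g b ∈ X → (H.Adj a b ↔ G.Adj (g a) (g b)) := by
    intro a b hb
    have hφb := (hfit b).1
    rw [if_pos hb] at hφb
    rw [(hfit a).2 b _ hφb]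
    simp [coverNeighbors, hb]
  refine ⟨fun a b hab => inv.inj a b (g a) (hfg a) (by rw [hab, hfg]),
    fun a => (inv.sound a (g a) (hfg a)).2.1, fun a b => ?_⟩
  by_cases hb : g b ∈ X
  · exact key a b hb
  by_cases ha : g a ∈ X
  · rw [H.adj_comm, G.adj_comm]
    exact key b a ha
  · have hφa := (hfit a).1
    have hφb := (hfit b).1
    rw [if_neg ha] at hφa
    rw [if_neg hb] at hφb
    refine iff_of_false (hindep a b hφa hφb) fun hadj => ?_
    rcases hX hadj with h1 | h1
    · exact ha (by simpa using h1)
    · exact hb (by simpa using h1)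

theorem exists_passResult_ne_none {n h : ℕ} {G : SimpleGraph (Fin n)} {X : Finset (Fin n)}
    {H : SimpleGraph (Fin h)} {L : List (Fin n)} {S : Finset (Fin n)}
    (hX : G.IsVertexCover (X : Set (Fin n))) (hL : L.Nodup) (hmem : ∀ v, v ∈ L)
    {g : Fin h → Fin n} (hg : IsCopy G H S g) :
    ∃ c < (X.card + 1) ^ h, passResult G X H L S c ≠ none := by
  obtain ⟨ginj, gS, gadj⟩ := hg
  obtain ⟨c, hc, hφ⟩ := exists_guess_eq (X := X)
    (φ := fun a => if g a ∈ X then some (g a) else none) (by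
      intro a v hv
      split_ifs at hv with ha
      rw [Option.some.injEq] at hv
      exact hv ▸ ha)
  refine ⟨c, hc, ?_⟩
  have inv := greedyInvariant_greedy G X H S (guess X h c) L hL
  unfold passResult outcome
  generalize guess X h c = φ at *
  generalize greedy G X H S φ L = f at *
  have hval : ∀ a, φ a = if g a ∈ X then some (g a) else none := fun a => by rw [hφ]
  have hfit : ∀ a, Fits X H φ (g a) (coverNeighbors G X (g a)) a := by
    intro a
    refine ⟨hval a, fun b u hb => ?_⟩
    rw [hval] at hb
    split_ifs at hb with hbX
    rw [Option.some.injEq] at hb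
    subst hb
    simp [coverNeighbors, hbX, gadj]
  have hindep : ∀ a b, φ a = none → φ b = none → ¬ H.Adj a b := by
    intro a b ha hb hadj
    rw [hval] at ha hb
    rcases hX ((gadj a b).1 hadj) with h1 | h1
    · simp [Finset.mem_coe.1 h1] at ha
    · simp [Finset.mem_coe.1 h1] at hb
  have hall : ∀ a, (f a).isSome := by
    intro a
    by_contra hnone
    rw [Option.not_isSome_iff_eq_none] at hnone
    -- Suppose role a is free. For each b in T, maximality puts g b in some role b', and b' lies in
    -- T because g b fits b'. This injects the finite set T into itself, so it is onto; as a lies in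
    -- T, role a is filled after all.
    let T := {b // Fits X H φ (g b) (coverNeighbors G X (g b)) a}
    have hex : ∀ b : T, ∃ b' : T, f b' = some (g b) := by
      rintro ⟨b, hb⟩
      obtain ⟨b', hb'⟩ := inv.maximal (g b) (hmem _) (gS b) a hb hnone
      have hbb' := (inv.sound b' _ hb').2.2
      refine ⟨⟨b', ?_, fun d u hd => ?_⟩, hb'⟩
      · rw [hb.1, ← hbb'.1, (hfit b').1]
      · rw [hb.2 d u hd, ← hbb'.2 d u hd, (hfit b').2 d u hd]
    choose m hm using hex
    have minj : Injective m := by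
      intro b b' hbb
      have h1 := hm b
      rw [hbb, hm b', Option.some.injEq] at h1
      exact Subtype.ext (ginj h1.symm)
    obtain ⟨b, hb⟩ := Finite.surjective_of_injective minj ⟨a, hfit a⟩
    have h1 := hm b
    rw [hb] at h1
    simp [hnone] at h1
  rw [dif_pos ⟨hall, hindep⟩]
  simp

/-! ### The branching over deleted vertices -/

abbrev SmallSet (n K : ℕ) : Type := {A : Finset (Fin n) // A.card ≤ K}

/-- The set `A` as a small set; junk if it is too large. -/
def SmallSet.ofFinset {n : ℕ} (K : ℕ) (A : Finset (Fin n)) : SmallSet n K :=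
  if hA : A.card ≤ K then ⟨A, hA⟩ else ⟨∅, by simp⟩

theorem SmallSet.coe_ofFinset {n K : ℕ} {A : Finset (Fin n)} (hA : A.card ≤ K) :
    (SmallSet.ofFinset K A : Finset (Fin n)) = A := by
  simp [SmallSet.ofFinset, hA]

/-- The position of the search: a word over `Fin h` (by its index) that says which vertex of each
copy of `H` to delete, the set of vertices deleted so far, and the guess to be tried next. -/
@[ext]
structure Position (n h K : ℕ) where
  word : Fin (h ^ K)
  deleted : SmallSet n K
  guess : Fin ((K + 1) ^ h)

/-- The position after a pass with result `r`, or the final answer. -/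
def advance {n h K : ℕ} (ℓ : Fin K) (o : Position n h K) (r : Option (Fin h → Fin n)) :
    Bool ⊕ Position n h K :=
  match r with
  | none =>
    if hc : o.guess.1 + 1 < (K + 1) ^ h then .inr ⟨o.word, o.deleted, ⟨_, hc⟩⟩ else .inl true
  | some g =>
    if hd : o.deleted.1.card < ℓ then
      .inr ⟨o.word, SmallSet.ofFinset K (insert
        (g (finFunctionFinEquiv.symm o.word ⟨o.deleted.1.card, hd.trans ℓ.2⟩)) o.deleted.1),
        ⟨0, by positivity⟩⟩
    else if hw : o.word.1 + 1 < h ^ K then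
      .inr ⟨⟨_, hw⟩, ⟨∅, by simp⟩, ⟨0, by positivity⟩⟩
    else .inl false

/-- From `o` the answer `b` is reached after exactly `p` steps of `δ`. -/
inductive Reaches {α : Type*} (δ : α → Bool ⊕ α) : α → ℕ → Bool → Prop
  | halt {o : α} {b : Bool} : δ o = .inl b → Reaches δ o 1 b
  | step {o o' : α} {p : ℕ} {b : Bool} :
      δ o = .inr o' → Reaches δ o' p b → Reaches δ o (p + 1) b

/-- The first result other than `none` among the first `N` guesses. -/
def firstResult {n h : ℕ} (R : Finset (Fin n) → ℕ → Option (Fin h → Fin n)) (N : ℕ)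
    (S : Finset (Fin n)) : Option (Fin h → Fin n) :=
  if hc : ∃ c, c < N ∧ R S c ≠ none then R S (Nat.find hc) else none

theorem firstResult_eq_of_first {n h N c : ℕ} {R : Finset (Fin n) → ℕ → Option (Fin h → Fin n)}
    {S : Finset (Fin n)} {g : Fin h → Fin n} (hlt : ∀ c' < c, R S c' = none) (hcN : c < N)
    (hc : R S c = some g) : firstResult R N S = some g := by
  have hex : ∃ c, c < N ∧ R S c ≠ none := ⟨c, hcN, by simp [hc]⟩
  have hfind : Nat.find hex = c := by
    rw [Nat.find_eq_iff]
    exact ⟨⟨hcN, by simp [hc]⟩, fun m hm hne => hne.2 (hlt m hm)⟩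
  rw [firstResult, dif_pos hex, hfind, hc]

theorem exists_of_firstResult_eq_some {n h N : ℕ}
    {R : Finset (Fin n) → ℕ → Option (Fin h → Fin n)} {S : Finset (Fin n)} {g : Fin h → Fin n}
    (hg : firstResult R N S = some g) : ∃ c, R S c = some g := by
  unfold firstResult at hg
  split_ifs at hg with hc
  exact ⟨_, hg⟩

/-- The vertices deleted after `i` steps if the word `ω` is followed and `F` finds copies. -/
def trace {n h K : ℕ} (F : Finset (Fin n) → Option (Fin h → Fin n)) (ω : Fin K → Fin h) :
    ℕ → Finset (Fin n)
  | 0 => ∅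
  | i + 1 =>
    match F (trace F ω i) with
    | none => trace F ω i
    | some g => if hi : i < K then insert (g (ω ⟨i, hi⟩)) (trace F ω i) else trace F ω i

/-- If every word fails, then there is no solution. -/
theorem exists_trace_eq_none {n h K : ℕ} {G : SimpleGraph (Fin n)} {H : SimpleGraph (Fin h)}
    {F : Finset (Fin n) → Option (Fin h → Fin n)} (hF : ∀ S g, F S = some g → IsCopy G H S g)
    (hh : 0 < h) (ℓ : Fin K) {Y : Finset (Fin n)} (hY : Y.card ≤ ℓ)
    (hfree : ∀ g, ¬ IsCopy G H Y g) : ∃ ω : Fin K → Fin h, F (trace F ω ℓ) = none := by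
  have hhit : ∀ S g, F S = some g → ∃ a, g a ∈ Y := by
    intro S g hg
    by_contra! hno
    obtain ⟨h1, -, h3⟩ := hF S g hg
    exact hfree g ⟨h1, hno, h3⟩
  -- A copy missing Y would survive the deletion of Y, so each copy found has a vertex in Y; `pick`
  -- chooses one.
  let pick : Finset (Fin n) → Fin h := fun S =>
    if hS : ∃ a, ∃ g, F S = some g ∧ g a ∈ Y then hS.choose else ⟨0, hh⟩
  have hpick : ∀ S g, F S = some g → g (pick S) ∈ Y := by
    intro S g hg
    obtain ⟨a, ha⟩ := hhit S g hg
    have hS : ∃ a, ∃ g, F S = some g ∧ g a ∈ Y := ⟨a, g, hg, ha⟩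
    obtain ⟨g', hg', hmem⟩ := hS.choose_spec
    rw [hg, Option.some.injEq] at hg'
    simp only [pick, dif_pos hS]
    exact hg' ▸ hmem
  let Z : ℕ → Finset (Fin n) := fun i => Nat.rec ∅ (fun _ S =>
    match F S with
    | none => S
    | some g => insert (g (pick S)) S) i
  have hZ : ∀ i, Z (i + 1) = match F (Z i) with
      | none => Z i
      | some g => insert (g (pick (Z i))) (Z i) := fun i => rfl
  let ω : Fin K → Fin h := fun i => pick (Z i)
  have htrace : ∀ i ≤ K, trace F ω i = Z i := by
    intro i
    induction i with
    | zero => intro _; rfl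
    | succ i ih =>
      intro hi
      rw [trace, ih (by omega), hZ]
      cases F (Z i) with
      | none => rfl
      | some g => simp [ω, show i < K by omega]
  -- Copies avoid the deleted set, so each deletion adds a new element of Y. After ℓ ≥ |Y| deletions
  -- all of Y is gone and no copy is left.
  have hsub : ∀ i, Z i ⊆ Y ∧ (F (Z i) = none ∨ (Z i).card = i) := by
    intro i
    induction i with
    | zero => exact ⟨by simp [Z], Or.inr (by simp [Z])⟩
    | succ i ih =>
      rw [hZ]
      cases hFi : F (Z i) with
      | none => exact ⟨ih.1, Or.inl hFi⟩
      | some g =>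
        refine ⟨Finset.insert_subset (hpick _ _ hFi) ih.1, Or.inr ?_⟩
        rw [Finset.card_insert_of_notMem ((hF _ _ hFi).2.1 _)]
        rcases ih.2 with hn | hn
        · simp [hFi] at hn
        · rw [hn]
  refine ⟨ω, ?_⟩
  rw [htrace _ ℓ.2.le]
  rcases (hsub ℓ).2 with hn | hn
  · exact hn
  · have hZY : Z ℓ = Y := Finset.eq_of_subset_of_card_le (hsub ℓ).1 (by omega)
    cases hFY : F (Z ℓ) with
    | none => rfl
    | some g => exact absurd (hZY ▸ hF _ _ hFY) (hfree g)

/-- Every deletion is of a new vertex, so the size of the deleted set counts the steps made along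
the current word. -/
structure PositionInvariant {n h K : ℕ} (R : Finset (Fin n) → ℕ → Option (Fin h → Fin n))
    (ℓ : Fin K) (o : Position n h K) : Prop where
  card_le : o.deleted.1.card ≤ ℓ
  eq_trace : o.deleted.1 = trace (firstResult R ((K + 1) ^ h)) (finFunctionFinEquiv.symm o.word)
    o.deleted.1.card
  guesses_fail : ∀ c < o.guess.1, R o.deleted.1 c = none
  words_fail : ∀ w < o.word, firstResult R ((K + 1) ^ h)
    (trace (firstResult R ((K + 1) ^ h)) (finFunctionFinEquiv.symm w) ℓ) ≠ none

/-- Mixed-radix value of (word, level, guess). It increases with every pass, so it bounds their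
number. -/
def Position.rank {n h K : ℕ} (o : Position n h K) : ℕ :=
  (o.word.1 * K + o.deleted.1.card) * (K + 1) ^ h + o.guess.1

theorem PositionInvariant.rank_lt {n h K : ℕ}
    {R : Finset (Fin n) → ℕ → Option (Fin h → Fin n)} {ℓ : Fin K} {o : Position n h K}
    (ho : PositionInvariant R ℓ o) : o.rank < h ^ K * K * (K + 1) ^ h := by
  have h1 := o.word.2
  have h2 := ho.card_le.trans_lt ℓ.2
  have h3 := o.guess.2
  have h4 : o.word.1 * K + o.deleted.1.card + 1 ≤ h ^ K * K := by nlinarith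
  unfold Position.rank
  nlinarith

theorem PositionInvariant.advance_eq_inr {n h K : ℕ} {G : SimpleGraph (Fin n)}
    {H : SimpleGraph (Fin h)} {R : Finset (Fin n) → ℕ → Option (Fin h → Fin n)}
    (hR : ∀ S c g, R S c = some g → IsCopy G H S g) {ℓ : Fin K} {o o' : Position n h K}
    (ho : PositionInvariant R ℓ o) (hadv : advance ℓ o (R o.deleted.1 o.guess) = .inr o') :
    PositionInvariant R ℓ o' ∧ o.rank < o'.rank := by
  cases hr : R o.deleted.1 o.guess with
  | none =>
    simp only [hr, advance] at hadv
    split_ifs at hadv with hc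
    rw [Sum.inr.injEq] at hadv
    subst hadv
    refine ⟨⟨ho.card_le, ho.eq_trace, fun c hlt => ?_, ho.words_fail⟩, ?_⟩
    · rcases Nat.lt_succ_iff_lt_or_eq.1 hlt with hlt | rfl
      · exact ho.guesses_fail c hlt
      · exact hr
    · simp [Position.rank]
  | some g =>
    have hfirst := firstResult_eq_of_first ho.guesses_fail o.guess.2 hr
    simp only [hr, advance] at hadv
    split_ifs at hadv with hd hw
    · rw [Sum.inr.injEq] at hadv
      subst hadv
      have hnot := (hR _ _ _ hr).2.1
        (finFunctionFinEquiv.symm o.word ⟨o.deleted.1.card, hd.trans ℓ.2⟩)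
      have hcard := Finset.card_insert_of_notMem hnot
      have hcoe := SmallSet.coe_ofFinset (hcard.trans_le (hd.trans ℓ.2))
      refine ⟨⟨?_, ?_, by simp, ho.words_fail⟩, ?_⟩
      · simp only [hcoe, hcard]
        exact hd
      · simp only [hcoe, hcard]
        rw [trace, ← ho.eq_trace, hfirst]
        simp [hd.trans ℓ.2]
      · simp only [Position.rank, hcoe, hcard]
        have := o.guess.2
        nlinarith
    · rw [Sum.inr.injEq] at hadv
      subst hadv
      have hcard : o.deleted.1.card = ℓ := le_antisymm ho.card_le (not_lt.1 hd)
      refine ⟨⟨by simp, by simp [trace], by simp, fun w hlt => ?_⟩, ?_⟩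
      · rcases Nat.lt_succ_iff_lt_or_eq.1 (Fin.lt_def.1 hlt) with hlt | heq
        · exact ho.words_fail w hlt
        · rw [Fin.ext heq, ← hcard, ← ho.eq_trace, hfirst]
          simp
      · have := o.guess.2
        have hK : o.deleted.1.card + 1 ≤ K := hcard ▸ ℓ.2
        simp only [Position.rank, Finset.card_empty]
        -- Resetting the level and the guess is paid for by the leading digit, since the level is at
        -- most K - 1.
        have hmul : (o.word.1 * K + o.deleted.1.card + 1) * (K + 1) ^ h ≤
            ((o.word.1 + 1) * K) * (K + 1) ^ h :=
          Nat.mul_le_mul_right _ (by rw [add_mul]; omega)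
        nlinarith

/-- YES comes when the last guess fails, so the deleted set is itself a solution. NO comes when the
last word still leaves a copy; then all words fail, which `exists_trace_eq_none` excludes if a
solution exists. -/
theorem PositionInvariant.advance_eq_inl {n h K : ℕ} {G : SimpleGraph (Fin n)}
    {H : SimpleGraph (Fin h)} {R : Finset (Fin n) → ℕ → Option (Fin h → Fin n)}
    (hR : ∀ S c g, R S c = some g → IsCopy G H S g)
    (hcomplete : ∀ S g, IsCopy G H S g → ∃ c < (K + 1) ^ h, R S c ≠ none) (hh : 0 < h)
    {ℓ : Fin K} {o : Position n h K} {b : Bool}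
    (ho : PositionInvariant R ℓ o) (hadv : advance ℓ o (R o.deleted.1 o.guess) = .inl b) :
    b = true ↔ HFreeDeletion G H ℓ := by
  rw [hFreeDeletion_iff]
  cases hr : R o.deleted.1 o.guess with
  | none =>
    simp only [hr, advance] at hadv
    split_ifs at hadv with hc
    rw [Sum.inl.injEq] at hadv
    subst hadv
    refine iff_of_true rfl ⟨o.deleted.1, ho.card_le, fun g hg => ?_⟩
    obtain ⟨c, hlt, hne⟩ := hcomplete _ _ hg
    rcases Nat.lt_or_ge c o.guess.1 with hcg | hcg
    · exact hne (ho.guesses_fail c hcg)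
    · have : c = o.guess.1 := by omega
      exact hne (this ▸ hr)
  | some g =>
    have hfirst := firstResult_eq_of_first ho.guesses_fail o.guess.2 hr
    simp only [hr, advance] at hadv
    split_ifs at hadv with hd hw
    rw [Sum.inl.injEq] at hadv
    subst hadv
    have hcard : o.deleted.1.card = ℓ := le_antisymm ho.card_le (not_lt.1 hd)
    refine iff_of_false (by simp) ?_
    rintro ⟨Y, hY, hfree⟩
    obtain ⟨ω, hω⟩ := exists_trace_eq_none (F := firstResult R ((K + 1) ^ h))
      (fun S g hg => (exists_of_firstResult_eq_some hg).elim fun c hc => hR S c g hc)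
      hh ℓ hY hfree
    obtain ⟨w, rfl⟩ := (finFunctionFinEquiv (m := h) (n := K)).symm.surjective ω
    rcases lt_or_ge w o.word with hlt | hge
    · exact ho.words_fail w hlt hω
    · have heq : w = o.word := Fin.ext (by have := w.2; have := Fin.le_def.1 hge; omega)
      rw [heq, ← hcard, ← ho.eq_trace, hfirst] at hω
      simp at hω

theorem PositionInvariant.exists_reaches {n h K : ℕ} {G : SimpleGraph (Fin n)}
    {H : SimpleGraph (Fin h)} {R : Finset (Fin n) → ℕ → Option (Fin h → Fin n)}
    (hR : ∀ S c g, R S c = some g → IsCopy G H S g)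
    (hcomplete : ∀ S g, IsCopy G H S g → ∃ c < (K + 1) ^ h, R S c ≠ none) (hh : 0 < h)
    {ℓ : Fin K} (o : Position n h K) (ho : PositionInvariant R ℓ o) :
    ∃ p b, Reaches (fun o => advance ℓ o (R o.deleted.1 o.guess)) o p b ∧
      (b = true ↔ HFreeDeletion G H ℓ) ∧ p + o.rank ≤ h ^ K * K * (K + 1) ^ h := by
  induction hm : h ^ K * K * (K + 1) ^ h - o.rank using Nat.strong_induction_on generalizing o with
  | _ m ih =>
  have hlt := ho.rank_lt
  cases hadv : advance ℓ o (R o.deleted.1 o.guess) with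
  | inl b => exact ⟨1, b, .halt hadv, ho.advance_eq_inl hR hcomplete hh hadv, by omega⟩
  | inr o' =>
    obtain ⟨ho', hrank⟩ := ho.advance_eq_inr hR hadv
    have hlt' := ho'.rank_lt
    obtain ⟨p, b, hp, hb, hle⟩ := ih _ (by omega) o' ho' rfl
    exact ⟨p + 1, b, .step hadv hp, hb, by omega⟩

/-! ### The memory and its contents during a pass -/

@[ext]
structure Instance (n h K : ℕ) where
  cover : SmallSet n K
  pattern : SimpleGraph (Fin h)
  budget : Fin K

/-- The memory used within a pass: the greedy assignment, and the block being read, with the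
neighbours in the vertex cover seen so far. -/
@[ext]
structure Scan (n h K : ℕ) where
  assignment : Fin h → Option (Fin n)
  block : Option (Fin n × SmallSet n K)

namespace Scan

variable {n h K : ℕ}

def start : Scan n h K := ⟨fun _ => none, none⟩

/-- The assignment after the pending block has been processed. -/
def flush (I : Instance n h K) (o : Position n h K) (s : Scan n h K) : Fin h → Option (Fin n) :=
  match s.block with
  | none => s.assignment
  | some (v, N) =>
    assign I.cover.1 I.pattern o.deleted.1 (HFreeStreaming.guess I.cover.1 h o.guess)
      s.assignment v N.1

/-- The stream does not mark the end of a block, so a block stays pending until the next vertex or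
the end of the pass. Neighbours outside the cover are dropped, which keeps the stored set within K
elements. -/
def next (I : Instance n h K) (o : Position n h K) (s : Scan n h K) : ALToken → Scan n h K
  | .vertex v => if hv : v < n then ⟨s.flush I o, some (⟨v, hv⟩, ⟨∅, by simp⟩)⟩ else s
  | .neighbor u =>
    match s.block with
    | none => s
    | some (v, N) =>
      if hu : ∃ hn : u < n, ⟨u, hn⟩ ∈ I.cover.1 then
        ⟨s.assignment, some (v, SmallSet.ofFinset K (insert ⟨u, hu.1⟩ N.1))⟩
      else s

theorem foldl_next_block (I : Instance n h K) (o : Position n h K) (s : Scan n h K) (v : Fin n)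
    (l : List (Fin n)) :
    (ALToken.vertex v :: l.map fun u : Fin n => ALToken.neighbor u.1).foldl (next I o) s =
      ⟨s.flush I o, some (v, SmallSet.ofFinset K (I.cover.1 ∩ l.toFinset))⟩ := by
  induction l using List.reverseRecOn with
  | nil => simp [next, SmallSet.ofFinset]
  | append_singleton l u ih =>
    rw [List.map_append, ← List.cons_append, List.foldl_append, ih]
    have hcoe : (SmallSet.ofFinset K (I.cover.1 ∩ l.toFinset)).1 = I.cover.1 ∩ l.toFinset :=
      SmallSet.coe_ofFinset ((Finset.card_le_card Finset.inter_subset_left).trans I.cover.2)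
    by_cases hu : u ∈ I.cover.1
    · simp [next, hu, hcoe, Finset.inter_insert_of_mem]
    · simp [next, hu]

theorem flush_foldl_next (G : SimpleGraph (Fin n)) (I : Instance n h K) (o : Position n h K)
    (blocks : List (Fin n × List (Fin n)))
    (hb : ∀ b ∈ blocks, ∀ u : Fin n, u ∈ b.2 ↔ G.Adj b.1 u) :
    ((alStream blocks).foldl (next I o) start).flush I o =
      greedy G I.cover.1 I.pattern o.deleted.1 (HFreeStreaming.guess I.cover.1 h o.guess)
        (blocks.map Prod.fst) := by
  induction blocks using List.reverseRecOn with
  | nil => rfl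
  | append_singleton bs b ih =>
    have ih := ih fun b' hb' => hb b' (by simp [hb'])
    have hN : I.cover.1 ∩ b.2.toFinset = coverNeighbors G I.cover.1 b.1 := by
      ext u
      simp [coverNeighbors, hb b (by simp) u]
    have hcoe : (SmallSet.ofFinset K (I.cover.1 ∩ b.2.toFinset)).1 =
        I.cover.1 ∩ b.2.toFinset :=
      SmallSet.coe_ofFinset ((Finset.card_le_card Finset.inter_subset_left).trans I.cover.2)
    have hs : alStream (bs ++ [b]) =
        alStream bs ++ (ALToken.vertex b.1 :: b.2.map fun u : Fin n => ALToken.neighbor u.1) := by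
      simp [alStream, ← List.map_eq_flatMap]
    rw [hN] at hcoe
    rw [hs, List.foldl_append, foldl_next_block, ih, hN]
    simp [flush, hcoe, greedy]

end Scan

/-- The memory contents: an answer, or the state of a search. -/
inductive Memory : Type
  | done (b : Bool) : Memory
  | run (n h K : ℕ) (I : Instance n h K) (o : Position n h K) (s : Scan n h K) : Memory

namespace Memory

/-- If the condition fails and H has an edge, the answer is YES. Otherwise h, K ≤ n and log n ≥ 1,
as the space bound needs. -/
def initial (n : ℕ) (X : Finset (Fin n)) (h : ℕ) (H : SimpleGraph (Fin h)) (ℓ : ℕ) : Memory :=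
  if hc : 2 ≤ n ∧ h ≤ n ∧ 0 < h ∧ ℓ < X.card then
    .run n h X.card ⟨⟨X, le_rfl⟩, H, ⟨ℓ, hc.2.2.2⟩⟩
      ⟨⟨0, Nat.pow_pos hc.2.2.1⟩, ⟨∅, by simp⟩, ⟨0, by positivity⟩⟩ Scan.start
  else .done true

def next : Memory → ALToken → Memory
  | .done b, _ => .done b
  | .run n h K I o s, t => .run n h K I o (s.next I o t)

def endPass : Memory → Memory
  | .done b => .done b
  | .run n h K I o s =>
    match advance I.budget o
      (outcome I.pattern (HFreeStreaming.guess I.cover.1 h o.guess) (s.flush I o)) with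
    | .inl b => .done b
    | .inr o' => .run n h K I o' Scan.start

def answer : Memory → Option Bool
  | .done b => some b
  | .run .. => none

theorem foldl_next_run {n h K : ℕ} (I : Instance n h K) (o : Position n h K) (s : Scan n h K)
    (τ : List ALToken) :
    τ.foldl next (.run n h K I o s) = .run n h K I o (τ.foldl (Scan.next I o) s) := by
  induction τ generalizing s with
  | nil => rfl
  | cons t τ ih => exact ih _

theorem endPass_foldl_next {n h K : ℕ} (G : SimpleGraph (Fin n)) (I : Instance n h K)
    (o : Position n h K) (blocks : List (Fin n × List (Fin n)))
    (hb : ∀ b ∈ blocks, ∀ u : Fin n, u ∈ b.2 ↔ G.Adj b.1 u) :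
    endPass ((alStream blocks).foldl next (.run n h K I o Scan.start)) =
      match advance I.budget o (passResult G I.cover.1 I.pattern (blocks.map Prod.fst)
        o.deleted.1 o.guess) with
      | .inl b => .done b
      | .inr o' => .run n h K I o' Scan.start := by
  rw [foldl_next_run]
  simp only [endPass, Scan.flush_foldl_next G I o blocks hb]
  rfl

/-! ### Coding the memory by bits -/

abbrev Contents (n h K : ℕ) : Type := Instance n h K × Position n h K × Scan n h K

/-- List the elements in a K-tuple, padded with `none`. -/
theorem card_smallSet_le (n K : ℕ) : Nat.card (SmallSet n K) ≤ (n + 1) ^ K := by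
  have hsurj : Surjective fun f : {f : Fin K → Option (Fin n) //
      (Finset.univ.biUnion fun i => (f i).toFinset).card ≤ K} =>
      (⟨Finset.univ.biUnion fun i => (f.1 i).toFinset, f.2⟩ : SmallSet n K) := by
    rintro ⟨A, hA⟩
    have hex : (Finset.univ.biUnion fun i : Fin K =>
        (if hi : i.1 < A.card then some ((A.equivFin.symm ⟨i, hi⟩ : A) : Fin n)
          else none).toFinset) = A := by
      ext v
      simp only [Finset.mem_biUnion, Finset.mem_univ, true_and, Option.mem_toFinset]
      constructor
      · rintro ⟨i, hi⟩
        split_ifs at hi with hlt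
        · simp only [Option.mem_def, Option.some.injEq] at hi
          rw [← hi]
          exact Finset.coe_mem _
        · simp at hi
      · intro hv
        refine ⟨⟨A.equivFin ⟨v, hv⟩, (A.equivFin ⟨v, hv⟩).2.trans_le hA⟩, ?_⟩
        simp
    exact ⟨⟨_, hex.symm ▸ hA⟩, Subtype.ext hex⟩
  calc Nat.card (SmallSet n K) ≤ _ := Nat.card_le_card_of_surjective _ hsurj
    _ ≤ Nat.card (Fin K → Option (Fin n)) := Nat.card_le_card_of_injective _ Subtype.val_injective
    _ = (n + 1) ^ K := by simp

theorem card_simpleGraph_le (h : ℕ) : Nat.card (SimpleGraph (Fin h)) ≤ 2 ^ (h ^ 2) := by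
  have hinj : Injective fun (H : SimpleGraph (Fin h)) (p : Fin h × Fin h) =>
      decide (H.Adj p.1 p.2) := by
    intro H H' heq
    ext a b
    simpa using congrFun heq (a, b)
  refine (Nat.card_le_card_of_injective _ hinj).trans_eq ?_
  simp [sq]

instance (n h K : ℕ) : Finite (Instance n h K) :=
  Finite.of_injective (fun I => (I.cover, I.pattern, I.budget)) fun I J hIJ => by
    simp only [Prod.mk.injEq] at hIJ
    exact Instance.ext hIJ.1 hIJ.2.1 hIJ.2.2

theorem card_instance_le (n h K : ℕ) :
    Nat.card (Instance n h K) ≤ (n + 1) ^ K * (2 ^ (h ^ 2) * K) := by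
  have hinj : Injective fun I : Instance n h K => (I.cover, I.pattern, I.budget) := fun I J hIJ => by
    simp only [Prod.mk.injEq] at hIJ
    exact Instance.ext hIJ.1 hIJ.2.1 hIJ.2.2
  refine (Nat.card_le_card_of_injective _ hinj).trans ?_
  rw [Nat.card_prod, Nat.card_prod, Nat.card_fin]
  gcongr
  · exact card_smallSet_le n K
  · exact card_simpleGraph_le h

instance (n h K : ℕ) : Finite (Position n h K) :=
  Finite.of_injective (fun o => (o.word, o.deleted, o.guess)) fun o o' ho => by
    simp only [Prod.mk.injEq] at ho
    exact Position.ext ho.1 ho.2.1 ho.2.2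

theorem card_position_le (n h K : ℕ) :
    Nat.card (Position n h K) ≤ h ^ K * ((n + 1) ^ K * (K + 1) ^ h) := by
  have hinj : Injective fun o : Position n h K => (o.word, o.deleted, o.guess) := fun o o' ho => by
    simp only [Prod.mk.injEq] at ho
    exact Position.ext ho.1 ho.2.1 ho.2.2
  refine (Nat.card_le_card_of_injective _ hinj).trans ?_
  rw [Nat.card_prod, Nat.card_prod, Nat.card_fin, Nat.card_fin]
  gcongr
  exact card_smallSet_le n K

instance (n h K : ℕ) : Finite (Scan n h K) :=
  Finite.of_injective (fun s => (s.assignment, s.block)) fun s s' hs => by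
    simp only [Prod.mk.injEq] at hs
    exact Scan.ext hs.1 hs.2

theorem card_scan_le (n h K : ℕ) :
    Nat.card (Scan n h K) ≤ (n + 1) ^ h * (n * (n + 1) ^ K + 1) := by
  have hinj : Injective fun s : Scan n h K => (s.assignment, s.block) := fun s s' hs => by
    simp only [Prod.mk.injEq] at hs
    exact Scan.ext hs.1 hs.2
  refine (Nat.card_le_card_of_injective _ hinj).trans ?_
  rw [Nat.card_prod, Finite.card_option, Nat.card_prod, Nat.card_fin, Nat.card_fun, Nat.card_fin,
    Finite.card_option, Nat.card_fin]
  gcongr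
  exact card_smallSet_le n K

theorem card_contents_le {n h K : ℕ} (hn : 2 ≤ n) (hhn : h ≤ n) (hKn : K ≤ n) (hh : 0 < h)
    (hK : 0 < K) : Nat.card (Contents n h K) ≤ n ^ (10 * (K + h ^ 2)) := by
  have hsq : n + 1 ≤ n ^ 2 := by nlinarith
  have h1 : (n + 1) ^ K ≤ n ^ (2 * K) := by
    rw [pow_mul]
    exact Nat.pow_le_pow_left hsq K
  have h2 : (n + 1) ^ h ≤ n ^ (2 * h) := by
    rw [pow_mul]
    exact Nat.pow_le_pow_left hsq h
  have h3 : (K + 1) ^ h ≤ n ^ (2 * h) := (Nat.pow_le_pow_left (by omega) h).trans h2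
  have h4 : n * (n + 1) ^ K + 1 ≤ n ^ (2 * K + 2) := by
    calc n * (n + 1) ^ K + 1 ≤ n * (n + 1) ^ K + (n + 1) ^ K := by
          gcongr
          exact Nat.one_le_pow _ _ (by omega)
      _ = (n + 1) ^ K * (n + 1) := by ring
      _ ≤ n ^ (2 * K) * n ^ 2 := Nat.mul_le_mul h1 hsq
      _ = n ^ (2 * K + 2) := by rw [pow_add]
  rw [Nat.card_prod, Nat.card_prod]
  calc _ ≤ ((n + 1) ^ K * (2 ^ (h ^ 2) * K)) * ((h ^ K * ((n + 1) ^ K * (K + 1) ^ h)) *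
        ((n + 1) ^ h * (n * (n + 1) ^ K + 1))) :=
        Nat.mul_le_mul (card_instance_le n h K)
          (Nat.mul_le_mul (card_position_le n h K) (card_scan_le n h K))
    _ ≤ (n ^ (2 * K) * (n ^ (h ^ 2) * n ^ 1)) * ((n ^ K * (n ^ (2 * K) * n ^ (2 * h))) *
        (n ^ (2 * h) * n ^ (2 * K + 2))) := by
        gcongr
        simpa using hKn
    _ = n ^ (2 * K + (h ^ 2 + 1) + (K + (2 * K + 2 * h) + (2 * h + (2 * K + 2)))) := by
        simp only [pow_add]
    _ ≤ n ^ (10 * (K + h ^ 2)) := Nat.pow_le_pow_right (by omega) (by nlinarith)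

/-- An injective code of the memory contents by natural numbers. -/
def code : Memory → ℕ
  -- The code 0 has no bits at all, which matters for n ≤ 1, where the space bound is 0.
  | .done true => 0
  | .done false => 1
  | .run n h K I o s =>
    Nat.pair n (Nat.pair h (Nat.pair K (Finite.equivFin (Contents n h K) (I, o, s)))) + 2

theorem code_injective : Injective code := by
  have hrun : ∀ n h K I o s n' h' K' I' o' s', code (.run n h K I o s) =
      code (.run n' h' K' I' o' s') →
      Memory.run n h K I o s = .run n' h' K' I' o' s' := by
    intro n h K I o s n' h' K' I' o' s' heq
    simp only [code, Nat.add_right_cancel_iff, Nat.pair_eq_pair] at heq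
    obtain ⟨rfl, rfl, rfl, hidx⟩ := heq
    have := (Finite.equivFin (Contents n h K)).injective (Fin.ext hidx)
    simp only [Prod.mk.injEq] at this
    obtain ⟨rfl, rfl, rfl⟩ := this
    rfl
  rintro (b | ⟨n, h, K, I, o, s⟩) (b' | ⟨n', h', K', I', o', s'⟩) heq
  · cases b <;> cases b' <;> simp [code] at heq ⊢
  · cases b <;> simp [code] at heq
  · cases b' <;> simp [code] at heq
  · exact hrun _ _ _ _ _ _ _ _ _ _ _ _ heq

theorem pair_lt_pow_two_mul {a b n e : ℕ} (ha : a < n ^ e) (hb : b < n ^ e) :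
    Nat.pair a b < n ^ (2 * e) := by
  refine (Nat.pair_lt_max_add_one_sq a b).trans_le ?_
  rw [mul_comm, pow_mul]
  exact Nat.pow_le_pow_left (max_lt ha hb) 2

/-- Each of the three pairings doubles the exponent, from 10E to 80E; the final + 2 costs at most
one more factor n. -/
theorem code_run_lt {n h K : ℕ} (hn : 2 ≤ n) (hhn : h ≤ n) (hKn : K ≤ n) (hh : 0 < h)
    (hK : 0 < K) (I : Instance n h K) (o : Position n h K) (s : Scan n h K) :
    code (.run n h K I o s) < n ^ (90 * (K + h ^ 2)) := by
  set E := K + h ^ 2 with hE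
  have hE1 : 1 ≤ E := by omega
  have hlt : ∀ m ≤ n, ∀ e, 2 ≤ e → m < n ^ e := fun m hm e he =>
    calc m ≤ n ^ 1 := by simpa using hm
      _ < n ^ e := Nat.pow_lt_pow_right (by omega) (by omega)
  have hidx : ((Finite.equivFin (Contents n h K) (I, o, s)) : ℕ) < n ^ (10 * E) :=
    (Fin.is_lt _).trans_le (card_contents_le hn hhn hKn hh hK)
  have h1 := pair_lt_pow_two_mul (hlt K hKn (10 * E) (by omega)) hidx
  have h2 := pair_lt_pow_two_mul (hlt h hhn _ (by omega)) h1
  have h3 := pair_lt_pow_two_mul (hlt n le_rfl _ (by omega)) h2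
  calc code (.run n h K I o s) < n ^ (2 * (2 * (2 * (10 * E)))) + 2 := by
        simp only [code]
        omega
    _ ≤ n ^ (2 * (2 * (2 * (10 * E)))) * 2 := by
        have := hlt 2 hn (2 * (2 * (2 * (10 * E)))) (by omega)
        omega
    _ ≤ n ^ (2 * (2 * (2 * (10 * E)))) * n ^ 1 := by
        gcongr
        simpa using hn
    _ = n ^ (2 * (2 * (2 * (10 * E))) + 1) := by rw [pow_add]
    _ ≤ n ^ (90 * E) := Nat.pow_le_pow_right (by omega) (by omega)

def encode (m : Memory) : List Bool := m.code.bits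

theorem bits_injective : Injective Nat.bits := by
  intro a b hab
  induction a using Nat.binaryRec' generalizing b with
  | zero =>
    cases b using Nat.binaryRec' with
    | zero => rfl
    | bit c b hb => simp [Nat.bits_append_bit _ _ hb] at hab
  | bit c a ha ih =>
    cases b using Nat.binaryRec' with
    | zero => simp [Nat.bits_append_bit _ _ ha] at hab
    | bit d b hb =>
      rw [Nat.bits_append_bit _ _ ha, Nat.bits_append_bit _ _ hb, List.cons.injEq] at hab
      rw [hab.1, ih hab.2]

theorem encode_injective : Injective encode := bits_injective.comp code_injective

theorem length_encode_run_le {n h K : ℕ} (hn : 2 ≤ n) (hhn : h ≤ n) (hKn : K ≤ n) (hh : 0 < h)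
    (hK : 0 < K) (I : Instance n h K) (o : Position n h K) (s : Scan n h K) :
    ((encode (.run n h K I o s)).length : ℝ) ≤ 100 * ((K : ℝ) + (h : ℝ) ^ 2) * Real.logb 2 n := by
  have hlog : 1 ≤ Real.logb 2 n := by
    rw [Real.le_logb_iff_rpow_le one_lt_two (by positivity)]
    simpa using (by exact_mod_cast hn : (2 : ℝ) ≤ n)
  have hE : (1 : ℝ) ≤ (K : ℝ) + (h : ℝ) ^ 2 := by
    exact_mod_cast (by omega : 1 ≤ K + h ^ 2)
  set x := code (.run n h K I o s) with hx
  have hxlt := code_run_lt hn hhn hKn hh hK I o s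
  have hx0 : x ≠ 0 := by simp [hx, code]
  have hsize : ((x.size - 1 : ℕ) : ℝ) ≤ 90 * ((K : ℝ) + (h : ℝ) ^ 2) * Real.logb 2 n := by
    have hpow : 2 ^ (x.size - 1) ≤ n ^ (90 * (K + h ^ 2)) :=
      (Nat.lt_size.1 (Nat.sub_lt (Nat.size_pos.2 (Nat.pos_of_ne_zero hx0)) one_pos)).trans hxlt.le
    have hpow' : (2 : ℝ) ^ (x.size - 1) ≤ (n : ℝ) ^ (90 * (K + h ^ 2)) := by exact_mod_cast hpow
    have := Real.logb_le_logb_of_le one_lt_two (by positivity) hpow'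
    rw [Real.logb_pow, Real.logb_pow, Real.logb_self_eq_one one_lt_two] at this
    push_cast at this
    linarith
  have hlen : (encode (.run n h K I o s)).length = x.size := Nat.size_eq_bits_len x
  rw [hlen]
  have hle : (x.size : ℝ) ≤ ((x.size - 1 : ℕ) : ℝ) + 1 := by
    exact_mod_cast (by omega : x.size ≤ x.size - 1 + 1)
  -- The one bit lost in rounding is absorbed because (K + h^2) log n ≥ 1.
  nlinarith [mul_le_mul hE hlog zero_le_one (by linarith)]

theorem length_encode_done_le (b : Bool) : (encode (.done b)).length ≤ 1 := by
  cases b <;> simp [encode, code]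

instance : Nonempty Memory := ⟨.done true⟩

def decode : List Bool → Memory := invFun encode

theorem decode_encode (m : Memory) : decode (encode m) = m := leftInverse_invFun encode_injective m

end Memory

/-! ### The streaming algorithm -/

def algorithm : StreamingAlgorithm where
  init n X h H ℓ := (Memory.initial n X h H ℓ).encode
  step m t := ((Memory.decode m).next t).encode
  endPass m := (Memory.decode m).endPass.encode
  output m := (Memory.decode m).answer

theorem read_encode (m : Memory) (τ : List ALToken) :
    algorithm.read m.encode τ = (τ.foldl Memory.next m).encode := by
  induction τ generalizing m with
  | nil => rfl
  | cons t τ ih =>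
    rw [List.foldl_cons, ← ih]
    simp [StreamingAlgorithm.read, algorithm, Memory.decode_encode]

/-- `afterPasses` splits off the last pass, whereas induction on `Reaches` needs the first. -/
theorem afterPasses_succ (A : StreamingAlgorithm) (σ : List ALToken) (m : List Bool) (q : ℕ) :
    A.afterPasses σ m (q + 1) = A.afterPasses σ (A.endPass (A.read m σ)) q := by
  induction q with
  | zero => rfl
  | succ q ih =>
    rw [StreamingAlgorithm.afterPasses, ih]
    rfl

theorem endPass_read_encode_run {n h K : ℕ} (G : SimpleGraph (Fin n)) (I : Instance n h K)
    (o : Position n h K) (blocks : List (Fin n × List (Fin n)))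
    (hb : ∀ b ∈ blocks, ∀ u : Fin n, u ∈ b.2 ↔ G.Adj b.1 u) :
    algorithm.endPass (algorithm.read (Memory.run n h K I o Scan.start).encode
        (alStream blocks)) =
      (match advance I.budget o (passResult G I.cover.1 I.pattern (blocks.map Prod.fst)
        o.deleted.1 o.guess) with
      | .inl b => Memory.done b
      | .inr o' => Memory.run n h K I o' Scan.start).encode := by
  rw [read_encode]
  refine Eq.trans ?_ (congrArg Memory.encode (Memory.endPass_foldl_next G I o blocks hb))
  simp [algorithm, Memory.decode_encode]

theorem haltsAfter_of_reaches {n h K : ℕ} {G : SimpleGraph (Fin n)} {I : Instance n h K}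
    {blocks : List (Fin n × List (Fin n))}
    (hb : ∀ b ∈ blocks, ∀ u : Fin n, u ∈ b.2 ↔ G.Adj b.1 u) {o : Position n h K} {p : ℕ}
    {b : Bool} (hp : Reaches (fun o => advance I.budget o (passResult G I.cover.1 I.pattern
      (blocks.map Prod.fst) o.deleted.1 o.guess)) o p b) :
    algorithm.HaltsAfter (alStream blocks) (Memory.run n h K I o Scan.start).encode p b := by
  induction hp with
  | @halt o b hadv =>
    refine ⟨fun q hq => ?_, ?_⟩
    · obtain rfl : q = 0 := by omega
      simp [StreamingAlgorithm.afterPasses, algorithm, Memory.decode_encode, Memory.answer]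
    · rw [afterPasses_succ, endPass_read_encode_run G I o blocks hb, hadv]
      simp [StreamingAlgorithm.afterPasses, algorithm, Memory.decode_encode, Memory.answer]
  | @step o o' p b hadv _ ih =>
    refine ⟨fun q hq => ?_, ?_⟩
    · rcases q with _ | q
      · simp [StreamingAlgorithm.afterPasses, algorithm, Memory.decode_encode, Memory.answer]
      · rw [afterPasses_succ, endPass_read_encode_run G I o blocks hb, hadv]
        exact ih.1 q (by omega)
    · rw [afterPasses_succ, endPass_read_encode_run G I o blocks hb, hadv]
      exact ih.2

/-- The memory holds an answer or a search with parameters `n`, `h`, `K`. -/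
def Memory.HasParameters (n h K : ℕ) (m : Memory) : Prop :=
  (∃ b, m = .done b) ∨ ∃ I o s, m = .run n h K I o s

theorem Memory.HasParameters.next {n h K : ℕ} {m : Memory} (hm : m.HasParameters n h K)
    (t : ALToken) : (m.next t).HasParameters n h K := by
  rcases hm with ⟨b, rfl⟩ | ⟨I, o, s, rfl⟩
  · exact Or.inl ⟨b, rfl⟩
  · exact Or.inr ⟨I, o, _, rfl⟩

theorem Memory.HasParameters.foldl_next {n h K : ℕ} {m : Memory} (hm : m.HasParameters n h K)
    (τ : List ALToken) : (τ.foldl Memory.next m).HasParameters n h K := by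
  induction τ generalizing m with
  | nil => exact hm
  | cons t τ ih => exact ih (hm.next t)

theorem Memory.HasParameters.endPass {n h K : ℕ} {m : Memory} (hm : m.HasParameters n h K) :
    m.endPass.HasParameters n h K := by
  rcases hm with ⟨b, rfl⟩ | ⟨I, o, s, rfl⟩
  · exact Or.inl ⟨b, rfl⟩
  · simp only [Memory.endPass]
    split
    · exact Or.inl ⟨_, rfl⟩
    · exact Or.inr ⟨_, _, _, rfl⟩

theorem exists_afterPasses_eq {n h K : ℕ} (σ : List ALToken) {m : Memory}
    (hm : m.HasParameters n h K) (q : ℕ) :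
    ∃ m' : Memory, m'.HasParameters n h K ∧ algorithm.afterPasses σ m.encode q = m'.encode := by
  induction q with
  | zero => exact ⟨m, hm, rfl⟩
  | succ q ih =>
    obtain ⟨m', hm', heq⟩ := ih
    refine ⟨_, (hm'.foldl_next σ).endPass, ?_⟩
    rw [StreamingAlgorithm.afterPasses, heq, read_encode]
    simp [algorithm, Memory.decode_encode]

theorem usesSpaceAtMost_of_hasParameters {n h K : ℕ} {m : Memory} (hm : m.HasParameters n h K)
    {s : ℝ} (hs : ∀ m' : Memory, m'.HasParameters n h K → (m'.encode.length : ℝ) ≤ s)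
    (σ : List ALToken) (p : ℕ) : algorithm.UsesSpaceAtMost σ m.encode p s := by
  refine ⟨fun q _ => ?_, fun q _ τ _ => ?_⟩
  · obtain ⟨m', hm', heq⟩ := exists_afterPasses_eq σ hm q
    exact heq ▸ hs m' hm'
  · obtain ⟨m', hm', heq⟩ := exists_afterPasses_eq σ hm q
    rw [heq, read_encode]
    exact hs _ (hm'.foldl_next τ)

theorem Memory.HasParameters.length_encode_le {n h K : ℕ} (hn : 2 ≤ n) (hhn : h ≤ n)
    (hKn : K ≤ n) (hh : 0 < h) (hK : 0 < K) {m : Memory} (hm : m.HasParameters n h K) :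
    (m.encode.length : ℝ) ≤ 100 * ((K : ℝ) + (h : ℝ) ^ 2) * Real.logb 2 n := by
  rcases hm with ⟨b, rfl⟩ | ⟨I, o, s, rfl⟩
  · have hlog : 1 ≤ Real.logb 2 n := by
      rw [Real.le_logb_iff_rpow_le one_lt_two (by positivity)]
      simpa using (by exact_mod_cast hn : (2 : ℝ) ≤ n)
    have hE : (1 : ℝ) ≤ (K : ℝ) + (h : ℝ) ^ 2 := by
      exact_mod_cast (by omega : 1 ≤ K + h ^ 2)
    have h1 : ((Memory.done b).encode.length : ℝ) ≤ 1 := by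
      exact_mod_cast Memory.length_encode_done_le b
    nlinarith [mul_le_mul hE hlog zero_le_one (by linarith)]
  · exact Memory.length_encode_run_le hn hhn hKn hh hK I o s

/-! ### The number of passes -/

theorem two_pow_le_two_mul_factorial (h : ℕ) : 2 ^ h ≤ 2 * h.factorial := by
  induction h with
  | zero => simp
  | succ h ih =>
    rcases Nat.eq_zero_or_pos h with rfl | hpos
    · simp
    · rw [pow_succ, Nat.factorial_succ]
      nlinarith [Nat.factorial_pos h]

/-- From x^h / h! ≤ e^x at x = K + 1, with e < 3. -/
theorem succ_pow_le_three_pow_mul_factorial (K h : ℕ) :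
    (K + 1) ^ h ≤ 3 ^ (K + 1) * h.factorial := by
  have h1 := Real.pow_div_factorial_le_exp ((K + 1 : ℕ) : ℝ) (by positivity) h
  have h2 : Real.exp ((K + 1 : ℕ) : ℝ) ≤ 3 ^ (K + 1) := by
    rw [← mul_one ((K + 1 : ℕ) : ℝ), Real.exp_nat_mul]
    exact pow_le_pow_left₀ (Real.exp_pos _).le Real.exp_one_lt_three.le _
  rw [div_le_iff₀ (by positivity)] at h1
  have h3 : (((K + 1 : ℕ) : ℝ)) ^ h ≤ 3 ^ (K + 1) * (h.factorial : ℝ) :=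
    h1.trans (mul_le_mul_of_nonneg_right h2 (by positivity))
  exact_mod_cast h3

theorem mul_three_pow_le (K : ℕ) : K * 3 ^ (K + 1) ≤ 100 * (2 ^ K * K.factorial) := by
  induction K with
  | zero => simp
  | succ K ih =>
    rcases (by omega : K = 0 ∨ K = 1 ∨ 2 ≤ K) with rfl | rfl | hK
    · simp
    · simp [Nat.factorial]
    · rw [pow_succ 3, pow_succ 2, Nat.factorial_succ]
      -- From K to K + 1 the left side grows by the factor 3(K+1)/K and the right side by 2(K+1),
      -- which is larger for K ≥ 2. Multiplying by K avoids the division.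
      have h1 : (K + 1) * 3 ≤ K * (2 * (K + 1)) := by nlinarith
      have h2 : K * ((K + 1) * (3 ^ (K + 1) * 3)) ≤
          K * (100 * (2 ^ K * 2 * ((K + 1) * K.factorial))) := by
        calc K * ((K + 1) * (3 ^ (K + 1) * 3)) = (K * 3 ^ (K + 1)) * ((K + 1) * 3) := by ring
          _ ≤ (100 * (2 ^ K * K.factorial)) * (K * (2 * (K + 1))) := Nat.mul_le_mul ih h1
          _ = _ := by ring
      exact Nat.le_of_mul_le_mul_left h2 (by omega)

/-- Uses K ≤ 2^K, K + 1 ≤ 2K and 2^h ≤ 2 · h!. -/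
theorem passes_le_pow {h K : ℕ} (hh : 0 < h) (hK : 0 < K) :
    h ^ K * K * (K + 1) ^ h ≤ 100 * (2 ^ K * h ^ (K + 2) * K ^ h * h.factorial) := by
  calc h ^ K * K * (K + 1) ^ h ≤ h ^ K * 2 ^ K * (2 * K) ^ h := by
        gcongr
        · exact Nat.lt_two_pow_self.le
        · omega
    _ = h ^ K * 2 ^ K * K ^ h * 2 ^ h := by rw [mul_pow]; ring
    _ ≤ h ^ (K + 2) * 2 ^ K * K ^ h * (2 * h.factorial) := by
        gcongr
        · omega
        · exact two_pow_le_two_mul_factorial h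
    _ = 2 * (2 ^ K * h ^ (K + 2) * K ^ h * h.factorial) := by ring
    _ ≤ _ := Nat.mul_le_mul_right _ (by norm_num)

theorem passes_le_factorial {h : ℕ} (hh : 0 < h) (K : ℕ) :
    h ^ K * K * (K + 1) ^ h ≤ 100 * (2 ^ K * h ^ (K + 2) * K.factorial * h.factorial) := by
  calc h ^ K * K * (K + 1) ^ h ≤ h ^ (K + 2) * K * (3 ^ (K + 1) * h.factorial) := by
        gcongr
        · omega
        · exact succ_pow_le_three_pow_mul_factorial K h
    _ = h ^ (K + 2) * h.factorial * (K * 3 ^ (K + 1)) := by ring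
    _ ≤ h ^ (K + 2) * h.factorial * (100 * (2 ^ K * K.factorial)) :=
        Nat.mul_le_mul_left _ (mul_three_pow_le K)
    _ = _ := by ring

/-- If K ≤ ℓ, delete X: the edge of H then has no image. Otherwise delete nothing: a copy would
force h ≤ n, and the edge forces h ≥ 2. -/
theorem hFreeDeletion_of_trivial {n h ℓ : ℕ} {G : SimpleGraph (Fin n)} {X : Finset (Fin n)}
    {H : SimpleGraph (Fin h)} (hX : G.IsVertexCover (X : Set (Fin n))) {a b : Fin h}
    (hab : H.Adj a b) (hc : ¬ (2 ≤ n ∧ h ≤ n ∧ 0 < h ∧ ℓ < X.card)) : HFreeDeletion G H ℓ := by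
  rw [hFreeDeletion_iff]
  by_cases hℓ : X.card ≤ ℓ
  · refine ⟨X, hℓ, fun g hg => ?_⟩
    rcases hX ((hg.2.2 a b).1 hab) with h1 | h1
    · exact hg.2.1 a (by simpa using h1)
    · exact hg.2.1 b (by simpa using h1)
  · refine ⟨∅, by simp, fun g hg => hc ?_⟩
    have hle : h ≤ n := by simpa using Fintype.card_le_of_injective g hg.1
    have hne : a.1 ≠ b.1 := fun heq => hab.ne (Fin.ext heq)
    have := a.2
    have := b.2
    exact ⟨by omega, hle, by omega, by omega⟩

end

end HFreeStreaming

open HFreeStreaming in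
theorem mainTheorem4 :
    ∃ (A : StreamingAlgorithm) (C : ℕ),
      ∀ (n h ℓ : ℕ) (G : SimpleGraph (Fin n)) (X : Finset (Fin n)) (H : SimpleGraph (Fin h))
        (blocks : List (Fin n × List (Fin n))),
        G.IsVertexCover (X : Set (Fin n)) →
        (∃ a b : Fin h, H.Adj a b) →
        IsALPresentation G blocks →
        ∃ (p : ℕ) (ans : Bool),
          A.HaltsAfter (alStream blocks) (A.init n X h H ℓ) p ans ∧
          (ans = true ↔ HFreeDeletion G H ℓ) ∧
          p ≤ C * (2 ^ X.card * h ^ (X.card + 2) * X.card ^ h * h.factorial) ∧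
          p ≤ C * (2 ^ X.card * h ^ (X.card + 2) * X.card.factorial * h.factorial) ∧
          A.UsesSpaceAtMost (alStream blocks) (A.init n X h H ℓ) p
            ((C : ℝ) * ((X.card : ℝ) + (h : ℝ) ^ 2) * Real.logb 2 (n : ℝ)) := by
  refine ⟨algorithm, 100, fun n h ℓ G X H blocks hX hH hblocks => ?_⟩
  obtain ⟨a, b, hab⟩ := hH
  by_cases hc : 2 ≤ n ∧ h ≤ n ∧ 0 < h ∧ ℓ < X.card
  · have hinit : algorithm.init n X h H ℓ = (Memory.initial n X h H ℓ).encode := rfl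
    rw [hinit, Memory.initial, dif_pos hc]
    obtain ⟨hn, hhn, hh, hℓ⟩ := hc
    set o : Position n h X.card :=
      ⟨⟨0, Nat.pow_pos hh⟩, ⟨∅, by simp⟩, ⟨0, by positivity⟩⟩ with ho
    set I : Instance n h X.card := ⟨⟨X, le_rfl⟩, H, ⟨ℓ, hℓ⟩⟩ with hI
    have hnodup := hblocks.vertices_nodup
    obtain ⟨p, ans, hp, hans, hle⟩ := PositionInvariant.exists_reaches (G := G) (H := H)
      (R := passResult G X H (blocks.map Prod.fst)) (ℓ := I.budget)
      (fun S c g hg => isCopy_of_passResult_eq_some hX hnodup hg)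
      (fun S g hg => exists_passResult_ne_none hX hnodup hblocks.vertices_complete hg) hh o
      ⟨by simp [ho], by simp [ho, trace], by simp [ho],
        fun w hw => absurd (Fin.lt_def.1 hw) (Nat.not_lt_zero _)⟩
    have hle : p ≤ h ^ X.card * X.card * (X.card + 1) ^ h := by omega
    have hKn : X.card ≤ n := by simpa using Finset.card_le_univ X
    refine ⟨p, ans, haltsAfter_of_reaches (I := I) hblocks.mem_neighbors_iff hp, hans,
      hle.trans (passes_le_pow hh (by omega)), hle.trans (passes_le_factorial hh _), ?_⟩
    exact usesSpaceAtMost_of_hasParameters (Or.inr ⟨_, _, _, rfl⟩)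
      (fun m hm => by
        simpa using hm.length_encode_le hn hhn hKn hh (by omega)) _ _
  · have hinit : algorithm.init n X h H ℓ = [] := by
      simp [algorithm, Memory.initial, dif_neg hc, Memory.encode, Memory.code]
    have hnil : ([] : List Bool) = (Memory.done true).encode := by
      simp [Memory.encode, Memory.code]
    have hlog : 0 ≤ Real.logb 2 (n : ℝ) := by
      rcases Nat.eq_zero_or_pos n with rfl | hn
      · simp
      · exact Real.logb_nonneg one_lt_two (by exact_mod_cast hn)
    rw [hinit]
    refine ⟨0, true, ⟨by simp, ?_⟩, iff_of_true rfl (hFreeDeletion_of_trivial hX hab hc),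
      by simp, by simp, ⟨fun q hq => ?_, by simp⟩⟩
    · rw [StreamingAlgorithm.afterPasses, hnil]
      simp [algorithm, Memory.decode_encode, Memory.answer]
    · obtain rfl : q = 0 := by omega
      simp only [StreamingAlgorithm.afterPasses, List.length_nil, Nat.cast_zero]
      positivity
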